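/- For integers $a\ge b\ge 1$, an $(a:b)$-coloring of a finite simple graph $H$ is a function assigning to each vertex of $H$ a $b$-element subset of $\{1,\ldots,a\}$ so that adjacent vertices receive disjoint sets. The fractional chromatic number $\chi_f(H)$ is the infimum of $a/b$ over all pairs of integers $a\ge b\ge 1$ such that $H$ has an $(a:b)$-coloring; $\chi(H)$ denotes the (ordinary) chromatic number. There is a constant $C$ such that for every positive integer $m$ there exists a finite triangle-free graph $H_m$ with $\chi(H_m)=\chi_f(H_m)=m$ and, if $m\ge 2$, with $|V(H_m)|\le C\,m^4\log^2 m$. -/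

import Mathlib

/-- `φ` is an `(a : b)`-coloring of `G`: it assigns to each vertex a `b`-element subset of a set
of `a` colors, so that adjacent vertices receive disjoint sets. -/
def SimpleGraph.IsABColoring {V : Type*} (G : SimpleGraph V) (a b : ℕ)
    (φ : V → Finset (Fin a)) : Prop :=
  (∀ v, (φ v).card = b) ∧ ∀ u v, G.Adj u v → Disjoint (φ u) (φ v)

/-- The fractional chromatic number of a finite graph `G`: the infimum of `a / b` over all pairs
of integers `a ≥ b ≥ 1` such that `G` has an `(a : b)`-coloring. (For a finite graph the set is
nonempty, and it is always bounded below by `1`, so this is a genuine infimum.) -/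
noncomputable def SimpleGraph.fractionalChromaticNumber {V : Type*} [Finite V]
    (G : SimpleGraph V) : ℝ :=
  sInf {x : ℝ | ∃ a b : ℕ, 1 ≤ b ∧ b ≤ a ∧ (∃ φ : V → Finset (Fin a), G.IsABColoring a b φ) ∧
    x = (a : ℝ) / (b : ℝ)}

namespace SimpleGraph

/-! A triangle-free graph `G` with independence ratio below `1 / m` is turned into one with `χ = χ_f
= m`. Deleting closed neighbourhoods of badly expanding independent sets leaves `W` on which each
independent `A` has a closed neighbourhood of size at least `m * |A|`. The tensor product of `G[W]`
with `K_m` is `m`-colorable, stays triangle-free by projection, and its independent sets have at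
most `|W|` of its `m * |W|` vertices, which forces `χ_f ≥ m`.

For `G`, split each line of an affine symplectic quadrangle over a field of prime order `q` into two
sides and join points on opposite sides. The quadrangle has no triangles beyond its lines. By a
union bound some splitting leaves only independent sets smaller than `2 * q ^ 2`, out of `q ^ 3`
points. Taking `q` linear in `m` gives `O(m ^ 4)` vertices. -/

/-- If every independent set of `U` has fewer than `|U| / m` vertices, then some nonempty set `W`
has the property that each independent `A ⊆ W` has a closed neighbourhood in `W` of size at least
`m * |A|`. -/
theorem exists_expanding_finset {V : Type*} [DecidableEq V] (G : SimpleGraph V) (m : ℕ) :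
    ∀ (U : Finset V), (∀ I ⊆ U, G.IsIndepSet (I : Set V) → m * I.card < U.card) →
      ∃ W : Finset V, W ⊆ U ∧ W.Nonempty ∧ ∀ A ⊆ W, G.IsIndepSet (A : Set V) →
        ∃ N ⊆ W, A ⊆ N ∧ (∀ v ∈ W, v ∈ N ↔ v ∈ A ∨ ∃ a ∈ A, G.Adj a v) ∧
          m * A.card ≤ N.card := by
  classical
  intro U
  induction U using Finset.strongInduction with
  | H U ih =>
    intro hU
    by_cases h : ∀ A ⊆ U, G.IsIndepSet (A : Set V) →
        m * A.card ≤ (U.filter fun v => v ∈ A ∨ ∃ a ∈ A, G.Adj a v).card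
    · refine ⟨U, subset_rfl, ?_, fun A hA hind => ⟨_, Finset.filter_subset _ _, ?_, ?_, h A hA hind⟩⟩
      · have := hU ∅ (Finset.empty_subset _) (by simp [IsIndepSet])
        exact Finset.card_pos.mp (by simpa using this)
      · intro v hv
        exact Finset.mem_filter.mpr ⟨hA hv, Or.inl hv⟩
      · intro v hv
        simp [hv]
    · push Not at h
      obtain ⟨A, hA, hind, hlt⟩ := h
      set N := U.filter fun v => v ∈ A ∨ ∃ a ∈ A, G.Adj a v with hN
      have hNU : N ⊆ U := Finset.filter_subset _ _
      have hAN : A ⊆ N := fun v hv => Finset.mem_filter.mpr ⟨hA hv, Or.inl hv⟩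
      have hApos : A.Nonempty := by
        rw [Finset.nonempty_iff_ne_empty]
        rintro rfl
        simp at hlt
      have hss : U \ N ⊂ U := by
        obtain ⟨a, ha⟩ := hApos
        refine Finset.ssubset_iff_subset_ne.mpr ⟨Finset.sdiff_subset, fun he => ?_⟩
        exact (Finset.mem_sdiff.mp (he.symm ▸ hA ha)).2 (hAN ha)
      -- The density hypothesis survives: `I ∪ A` is independent, so `m|I| < |U| - m|A| < |U| -
      -- |N|`.
      obtain ⟨W, hWU, hW⟩ := ih (U \ N) hss (by
        intro I hI hIind
        have hdisj : Disjoint I A := by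
          rw [Finset.disjoint_left]
          intro v hv hvA
          exact (Finset.mem_sdiff.mp (hI hv)).2 (hAN hvA)
        have hadj : ∀ v ∈ I, ∀ a ∈ A, ¬ G.Adj a v := by
          intro v hv a ha hav
          have := Finset.mem_sdiff.mp (hI hv)
          exact this.2 (Finset.mem_filter.mpr ⟨this.1, Or.inr ⟨a, ha, hav⟩⟩)
        have hun := hU (I ∪ A)
          (Finset.union_subset (hI.trans Finset.sdiff_subset) hA) (by
            intro x hx y hy hxy hadj'
            simp only [Finset.coe_union, Set.mem_union, Finset.mem_coe] at hx hy
            rcases hx with hx | hx <;> rcases hy with hy | hy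
            · exact hIind hx hy hxy hadj'
            · exact hadj x hx y hy hadj'.symm
            · exact hadj y hy x hx hadj'
            · exact hind hx hy hxy hadj')
        rw [Finset.card_union_of_disjoint hdisj, mul_add] at hun
        have hc := Finset.card_sdiff_add_card_eq_card hNU
        omega)
      exact ⟨W, hWU.trans Finset.sdiff_subset, hW⟩

/-! ### Tensor products with complete graphs -/

/-- The tensor product of `G` with the complete graph on `m` vertices. -/
def tensorComplete {V : Type*} (G : SimpleGraph V) (m : ℕ) : SimpleGraph (V × Fin m) where
  Adj x y := G.Adj x.1 y.1 ∧ x.2 ≠ y.2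
  symm := ⟨fun _ _ h => ⟨h.1.symm, h.2.symm⟩⟩
  loopless := ⟨fun _ h => h.2 rfl⟩

theorem tensorComplete_colorable {V : Type*} (G : SimpleGraph V) (m : ℕ) :
    (G.tensorComplete m).Colorable m :=
  ⟨Coloring.mk Prod.snd fun h => h.2⟩

theorem CliqueFree.of_hom {V W : Type*} {G : SimpleGraph V} {H : SimpleGraph W} {k : ℕ}
    (h : H.CliqueFree k) (f : G →g H) : G.CliqueFree k := by
  rw [cliqueFree_iff] at h ⊢
  refine ⟨fun e => h.elim ?_⟩
  let g : completeGraph (Fin k) →g H := f.comp e.toHom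
  exact ⟨g, g.injective_of_top_hom⟩

theorem CliqueFree.tensorComplete {V : Type*} {G : SimpleGraph V} {k : ℕ} (h : G.CliqueFree k)
    (m : ℕ) : (G.tensorComplete m).CliqueFree k :=
  h.of_hom ⟨Prod.fst, fun h => h.1⟩

/-- If closed neighbourhoods of independent sets expand by a factor `m`, then independent sets
of the tensor product with the complete graph on `m` vertices have at most `|V|` elements. -/
theorem card_le_of_isIndepSet_tensorComplete {V : Type*} [Fintype V] [DecidableEq V]
    (G : SimpleGraph V) (m : ℕ)
    (hexp : ∀ A : Finset V, G.IsIndepSet (A : Set V) →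
      ∃ N : Finset V, A ⊆ N ∧ (∀ v ∈ N, v ∈ A ∨ ∃ a ∈ A, G.Adj a v) ∧ m * A.card ≤ N.card)
    (S : Finset (V × Fin m)) (hS : (G.tensorComplete m).IsIndepSet (S : Set (V × Fin m))) :
    S.card ≤ Fintype.card V := by
  classical
  let c : V → Finset (Fin m) := fun v => Finset.univ.filter fun i => (v, i) ∈ S
  have hcard : S.card = ∑ v, (c v).card := by
    rw [Finset.card_eq_sum_card_fiberwise (f := Prod.fst) (t := Finset.univ) (by simp)]
    refine Finset.sum_congr rfl fun v _ => ?_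
    refine (Finset.card_bij (fun i _ => (v, i)) ?_ ?_ ?_).symm
    · intro i hi
      simpa [c] using hi
    · intro i _ j _ h
      exact (Prod.mk.inj h).2
    · rintro ⟨w, i⟩ h
      simp only [Finset.mem_filter] at h
      obtain ⟨h, rfl⟩ := h
      exact ⟨i, by simpa [c] using h, rfl⟩
  -- A vertex with two colours excludes every colour at its neighbours. Hence `A` is independent and
  -- the surplus on `A` is paid for by its empty neighbours.
  let A : Finset V := Finset.univ.filter fun v => 1 < (c v).card
  have hnbr : ∀ a ∈ A, ∀ v, G.Adj a v → c v = ∅ := by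
    intro a ha v hav
    rw [Finset.eq_empty_iff_forall_notMem]
    intro j hj
    obtain ⟨i, hi, hij⟩ := Finset.exists_mem_ne (Finset.mem_filter.mp ha).2 j
    have h1 : (a, i) ∈ S := (Finset.mem_filter.mp hi).2
    have h2 : (v, j) ∈ S := (Finset.mem_filter.mp hj).2
    exact hS h1 h2 (fun h => hij (Prod.mk.inj h).2) ⟨hav, hij⟩
  have hA : G.IsIndepSet (A : Set V) := by
    intro u hu v hv _ huv
    have h0 := hnbr u hu v huv
    have h1 := (Finset.mem_filter.mp (Finset.mem_coe.mp hv)).2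
    simp [h0] at h1
  obtain ⟨N, hAN, hN, hle⟩ := hexp A hA
  have h1 : ∑ v ∈ N, (c v).card ≤ N.card := by
    have : ∑ v ∈ N, (c v).card = ∑ v ∈ A, (c v).card := by
      refine (Finset.sum_subset hAN fun v hv hvA => ?_).symm
      obtain ⟨a, ha, hav⟩ := (hN v hv).resolve_left hvA
      simp [hnbr a ha v hav]
    rw [this]
    calc ∑ v ∈ A, (c v).card ≤ ∑ _v ∈ A, m :=
          Finset.sum_le_sum fun v _ => (Finset.card_le_univ _).trans (by simp)
      _ = m * A.card := by simp [mul_comm]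
      _ ≤ N.card := hle
  have h2 : ∑ v ∈ Nᶜ, (c v).card ≤ (Nᶜ).card := by
    rw [Finset.card_eq_sum_ones]
    refine Finset.sum_le_sum fun v hv => ?_
    by_contra h
    exact Finset.mem_compl.mp hv (hAN (Finset.mem_filter.mpr ⟨Finset.mem_univ _, not_le.mp h⟩))
  rw [hcard, ← Finset.sum_add_sum_compl N, ← Finset.card_add_card_compl N]
  omega

/-! ### Fractional colorings -/

/-- Double counting: an `(a : b)`-coloring of a graph whose independent sets have at most `k`
vertices satisfies `b * |V| ≤ a * k`. -/
theorem IsABColoring.mul_card_le {V : Type*} [Fintype V] {G : SimpleGraph V} {a b k : ℕ}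
    {φ : V → Finset (Fin a)} (hφ : G.IsABColoring a b φ)
    (hk : ∀ S : Finset V, G.IsIndepSet (S : Set V) → S.card ≤ k) :
    b * Fintype.card V ≤ a * k := by
  classical
  have h := Finset.sum_card_bipartiteAbove_eq_sum_card_bipartiteBelow
    (s := (Finset.univ : Finset V)) (t := (Finset.univ : Finset (Fin a))) fun v i => i ∈ φ v
  have h1 : ∑ v : V, (Finset.univ.bipartiteAbove (fun v i => i ∈ φ v) v).card
      = b * Fintype.card V := by
    simp [Finset.bipartiteAbove, hφ.1, mul_comm]
  have h2 : ∑ i : Fin a, (Finset.univ.bipartiteBelow (fun v i => i ∈ φ v) i).card ≤ a * k := by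
    calc _ ≤ ∑ _i : Fin a, k := Finset.sum_le_sum fun i _ => hk _ (by
            intro u hu v hv _ huv
            simp only [Finset.bipartiteBelow, Finset.coe_filter, Finset.mem_univ, true_and,
              Set.mem_ofPred_eq] at hu hv
            exact Finset.disjoint_left.mp (hφ.2 u v huv) hu hv)
      _ = a * k := by simp
  rw [← h1, h]
  exact h2

theorem Coloring.isABColoring {V : Type*} {G : SimpleGraph V} {k : ℕ} (C : G.Coloring (Fin k)) :
    G.IsABColoring k 1 fun v => {C v} :=
  ⟨fun _ => Finset.card_singleton _, fun _ _ h => by simpa using C.valid h⟩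

/-- An `m`-colorable graph on `m * k > 0` vertices without independent sets of more than `k`
vertices has chromatic number and fractional chromatic number `m`. -/
theorem chromaticNumber_eq_and_fractionalChromaticNumber_eq {V : Type*} [Fintype V]
    {G : SimpleGraph V} {m k : ℕ} (hm : 1 ≤ m) (hk : 0 < k) (hV : Fintype.card V = m * k)
    (hcol : G.Colorable m) (hind : ∀ S : Finset V, G.IsIndepSet (S : Set V) → S.card ≤ k) :
    G.chromaticNumber = (m : ℕ∞) ∧ G.fractionalChromaticNumber = (m : ℝ) := by
  have key : ∀ a b : ℕ, (∃ φ : V → Finset (Fin a), G.IsABColoring a b φ) → b * m ≤ a := by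
    rintro a b ⟨φ, hφ⟩
    have := hφ.mul_card_le hind
    rw [hV, ← mul_assoc] at this
    exact Nat.le_of_mul_le_mul_right this hk
  obtain ⟨C⟩ := hcol
  constructor
  · refine le_antisymm (Colorable.chromaticNumber_le ⟨C⟩) ?_
    rw [le_chromaticNumber_iff_colorable]
    rintro n ⟨D⟩
    simpa using key n 1 ⟨_, D.isABColoring⟩
  · refine IsLeast.csInf_eq ⟨⟨m, 1, le_rfl, hm, ⟨_, C.isABColoring⟩, by simp⟩, ?_⟩
    rintro x ⟨a, b, hb, -, hφ, rfl⟩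
    rw [le_div_iff₀ (by exact_mod_cast hb), mul_comm]
    exact_mod_cast key a b hφ

/-! ### Randomly split generalized quadrangle -/

/-- The points of `F ^ 3`, where two points on a common line of the affine part of the symplectic
generalized quadrangle are adjacent when `f` separates them on this line. The line is given by a
point and the slope of its projection to the first two coordinates. -/
def quadrangleGraph {F : Type*} [Field F] (f : F × F × F → F → Bool) :
    SimpleGraph (F × F × F) where
  Adj p r := p.1 ≠ r.1 ∧ p.2.2 - r.2.2 = r.1 * p.2.1 - p.1 * r.2.1 ∧
    f p ((p.2.1 - r.2.1) / (p.1 - r.1)) ≠ f r ((p.2.1 - r.2.1) / (p.1 - r.1))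
  symm := ⟨by
    rintro p r ⟨h1, h2, h3⟩
    refine ⟨h1.symm, by linear_combination -h2, ?_⟩
    rw [← neg_sub p.2.1, ← neg_sub p.1, neg_div_neg_eq]
    exact h3.symm⟩
  loopless := ⟨fun _ h => h.1 rfl⟩

/-- Combining the three incidence relations makes the slopes equal, so a triangle lies on one line,
which has only two sides. -/
theorem quadrangleGraph_cliqueFree {F : Type*} [Field F] (f : F × F × F → F → Bool) :
    (quadrangleGraph f).CliqueFree 3 := by
  classical
  intro s hs
  obtain ⟨p, r, t, ⟨h1, h2, h3⟩, ⟨k1, k2, k3⟩, ⟨l1, l2, l3⟩, -⟩ := is3Clique_iff.mp hs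
  have e1 : p.1 - r.1 ≠ 0 := sub_ne_zero.mpr h1
  have e2 : p.1 - t.1 ≠ 0 := sub_ne_zero.mpr k1
  have e3 : r.1 - t.1 ≠ 0 := sub_ne_zero.mpr l1
  have s1 : (p.2.1 - t.2.1) / (p.1 - t.1) = (p.2.1 - r.2.1) / (p.1 - r.1) := by
    rw [div_eq_div_iff e2 e1]
    linear_combination h2 - k2 + l2
  have s2 : (r.2.1 - t.2.1) / (r.1 - t.1) = (p.2.1 - r.2.1) / (p.1 - r.1) := by
    rw [div_eq_div_iff e3 e1]
    linear_combination h2 - k2 + l2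
  rw [s1] at k3
  rw [s2] at l3
  generalize f p _ = x at *
  generalize f r _ = y at *
  generalize f t _ = z at *
  revert h3 k3 l3
  cases x <;> cases y <;> cases z <;> decide

/-- The line through `p` with slope `s`, as a triple of coordinates. -/
def quadrangleLine {F : Type*} [Field F] (p : F × F × F) (s : F) : F × F × F :=
  (s, p.1 * s - p.2.1, p.1 * (p.1 * s - p.2.1) - p.2.2)

/-- Points of an independent set on a common line must lie on the same side, since opposite sides
are adjacent. -/
theorem eq_of_quadrangleLine_eq {F : Type*} [Field F] {f : F × F × F → F → Bool}
    {T : Set (F × F × F)} (hT : (quadrangleGraph f).IsIndepSet T) {p r : F × F × F} (hp : p ∈ T)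
    (hr : r ∈ T) {s u : F} (h : quadrangleLine p s = quadrangleLine r u) : f p s = f r u := by
  obtain ⟨p1, p2, p3⟩ := p
  obtain ⟨r1, r2, r3⟩ := r
  simp only [quadrangleLine, Prod.mk.injEq] at h
  obtain ⟨rfl, h2, h3⟩ := h
  by_cases he : p1 = r1
  · subst he
    have : p2 = r2 := by linear_combination -h2
    subst this
    have : p3 = r3 := by linear_combination -h3
    rw [this]
  · by_contra hf
    have e1 : p1 - r1 ≠ 0 := sub_ne_zero.mpr he
    have hs : (p2 - r2) / (p1 - r1) = s := by
      rw [div_eq_iff e1]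
      linear_combination -h2
    refine hT hp hr (fun h => he (Prod.mk.inj h).1) ⟨he, ?_, ?_⟩
    · simp only
      linear_combination -h3 + (p1 + r1) * h2
    · simpa only [hs] using hf

/-- The number of functions `f` for which `T` is independent in `quadrangleGraph f`. -/
theorem card_quadrangleGraph_indep_le {F : Type*} [Field F] [Fintype F] [DecidableEq F]
    (T : Finset (F × F × F)) (B : Finset (F × F × F → F → Bool))
    (hB : ∀ f ∈ B, (quadrangleGraph f).IsIndepSet (T : Set (F × F × F))) :
    B.card ≤ 2 ^ (Fintype.card F ^ 3 +
      (Fintype.card F ^ 3 - T.card) * Fintype.card F) := by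
  classical
  let L : (F × F × F → F → Bool) → F × F × F → Bool := fun f l =>
    decide (∃ p ∈ T, ∃ s, quadrangleLine p s = l ∧ f p s = true)
  have hL : ∀ f ∈ B, ∀ p ∈ T, ∀ s, L f (quadrangleLine p s) = f p s := by
    intro f hf p hp s
    rw [Bool.eq_iff_iff, decide_eq_true_iff]
    constructor
    · rintro ⟨r, hr, u, hl, hu⟩
      rw [← hu]
      exact (eq_of_quadrangleLine_eq (hB f hf) hr hp hl).symm
    · exact fun h => ⟨p, hp, s, rfl, h⟩
  -- One bit per line determines `f` on `T`; the values outside `T` are stored in full.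
  let Φ : (F × F × F → F → Bool) →
      (F × F × F → Bool) × ({p : F × F × F // p ∈ Tᶜ} → F → Bool) :=
    fun f => (L f, fun p => f p.1)
  have hinj : Set.InjOn Φ B := by
    intro f hf g hg hfg
    obtain ⟨h1, h2⟩ := Prod.mk.inj hfg
    funext p s
    by_cases hp : p ∈ T
    · rw [← hL f hf p hp s, ← hL g hg p hp s, h1]
    · exact congrFun (congrFun h2 ⟨p, Finset.mem_compl.mpr hp⟩) s
  calc B.card ≤ (Finset.univ : Finset ((F × F × F → Bool) ×
        ({p : F × F × F // p ∈ Tᶜ} → F → Bool))).card :=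
        Finset.card_le_card_of_injOn Φ (fun _ _ => Finset.mem_coe.mpr (Finset.mem_univ _)) hinj
    _ = _ := by
        simp only [Finset.card_univ, Fintype.card_prod, Fintype.card_fun, Fintype.card_bool,
          Fintype.card_coe, Finset.card_compl, ← pow_mul, ← pow_add]
        congr 1
        ring_nf

/-- Used to beat the number of candidate sets in the union bound; the inequality fails at `q = 29`.
-/
theorem pow_six_lt_two_pow {q : ℕ} (hq : 30 ≤ q) : q ^ 6 < 2 ^ q := by
  induction q, hq using Nat.le_induction with
  | base => norm_num
  | succ q hq ih =>
    have h : (q + 1) ^ 6 ≤ 2 * q ^ 6 := by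
      obtain ⟨d, rfl⟩ := Nat.exists_eq_add_of_le hq
      ring_nf
      omega
    rw [pow_succ 2]
    omega

/-- For some choice of `f`, independent sets of `quadrangleGraph f` have less than `2 * |F| ^ 2`
vertices. -/
theorem exists_quadrangleGraph_indep_lt {F : Type*} [Field F] [Fintype F] [DecidableEq F]
    (hF : 30 ≤ Fintype.card F) :
    ∃ f : F × F × F → F → Bool, ∀ T : Finset (F × F × F),
      (quadrangleGraph f).IsIndepSet (T : Set (F × F × F)) → T.card < 2 * Fintype.card F ^ 2 := by
  classical
  set q := Fintype.card F with hq
  by_contra! hcon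
  let B : Finset (F × F × F) → Finset (F × F × F → F → Bool) := fun T =>
    Finset.univ.filter fun f => (quadrangleGraph f).IsIndepSet (T : Set (F × F × F))
  let P := (Finset.univ : Finset (F × F × F)).powersetCard (2 * q ^ 2)
  have hcov : (Finset.univ : Finset (F × F × F → F → Bool)) ⊆ P.biUnion B := by
    intro f _
    obtain ⟨T, hT, hc⟩ := hcon f
    obtain ⟨S, hST, hS⟩ := Finset.exists_subset_card_eq hc
    refine Finset.mem_biUnion.mpr ⟨S, Finset.mem_powersetCard.mpr ⟨Finset.subset_univ _, hS⟩, ?_⟩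
    exact Finset.mem_filter.mpr ⟨Finset.mem_univ _,
      hT.mono (Finset.coe_subset.mpr hST)⟩
  have hn : Fintype.card (F × F × F) = q ^ 3 := by
    simp only [Fintype.card_prod, ← hq]
    ring
  have hle : 2 * q ^ 2 ≤ q ^ 3 := by
    rw [pow_succ q 2, mul_comm]
    exact Nat.mul_le_mul_left _ (by omega)
  -- Union bound: each `T` of size `2 * q ^ 2` is independent for at most a `2 ^ (-q ^ 3)` fraction
  -- of all `f`, and there are at most `(q ^ 6) ^ (q ^ 2)` such `T`.
  have h1 : (2 : ℕ) ^ (q ^ 3 * q) ≤ (q ^ 3) ^ (2 * q ^ 2) * 2 ^ (q ^ 3 + (q ^ 3 - 2 * q ^ 2) * q) := by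
    calc (2 : ℕ) ^ (q ^ 3 * q)
        = (Finset.univ : Finset (F × F × F → F → Bool)).card := by
          simp only [Finset.card_univ, Fintype.card_fun, Fintype.card_bool, hn, ← hq, ← pow_mul]
          rw [mul_comm]
      _ ≤ (P.biUnion B).card := Finset.card_le_card hcov
      _ ≤ P.card * 2 ^ (q ^ 3 + (q ^ 3 - 2 * q ^ 2) * q) := by
          refine Finset.card_biUnion_le_card_mul _ _ _ fun T hT => ?_
          have := card_quadrangleGraph_indep_le T (B T) fun f hf => (Finset.mem_filter.mp hf).2
          rwa [(Finset.mem_powersetCard.mp hT).2, ← hq] at this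
      _ ≤ _ := by
          refine Nat.mul_le_mul_right _ ?_
          rw [Finset.card_powersetCard, Finset.card_univ, hn]
          exact Nat.choose_le_pow _ _
  have h2 : (q ^ 3) ^ (2 * q ^ 2) < 2 ^ (q ^ 3) := by
    have : (q ^ 3) ^ (2 * q ^ 2) = (q ^ 6) ^ (q ^ 2) := by rw [← pow_mul, ← pow_mul]; ring_nf
    rw [this, show q ^ 3 = q * q ^ 2 by ring, pow_mul]
    exact Nat.pow_lt_pow_left (pow_six_lt_two_pow hF) (by positivity)
  have h3 : q ^ 3 + (q ^ 3 + (q ^ 3 - 2 * q ^ 2) * q) = q ^ 3 * q := by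
    obtain ⟨d, hd⟩ := Nat.exists_eq_add_of_le hle
    have hd' : q ^ 3 - 2 * q ^ 2 = d := by omega
    rw [hd']
    have : q ^ 3 * q = 2 * q ^ 3 + d * q := by rw [hd]; nlinarith [hd]
    omega
  have h4 := Nat.mul_lt_mul_of_pos_right h2
    (show 0 < 2 ^ (q ^ 3 + (q ^ 3 - 2 * q ^ 2) * q) by positivity)
  rw [← pow_add, h3] at h4
  omega

/-! ### Assembly -/

/-- A triangle-free graph whose independent sets have at most `k` of its `m * k` vertices. -/
theorem exists_triangleFree_colorable_indep_le (m : ℕ) (hm : 1 ≤ m) :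
    ∃ (n k : ℕ) (H : SimpleGraph (Fin n)), n = m * k ∧ 0 < k ∧ k ≤ (84 * m) ^ 3 ∧
      H.CliqueFree 3 ∧ H.Colorable m ∧
      ∀ S : Finset (Fin n), H.IsIndepSet (S : Set (Fin n)) → S.card ≤ k := by
  classical
  -- `q ≥ 2 * m` gives ratio below `1 / m`, the `40` secures `q ≥ 30`, and `q ≤ 4 * m + 80 ≤ 84 *
  -- m`.
  obtain ⟨q, hqp, hq1, hq2⟩ := Nat.exists_prime_lt_and_le_two_mul (2 * m + 40) (by omega)
  have := Fact.mk hqp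
  have hcard : Fintype.card (ZMod q) = q := ZMod.card q
  obtain ⟨f, hf⟩ := exists_quadrangleGraph_indep_lt (F := ZMod q) (by omega)
  rw [hcard] at hf
  have hn : Fintype.card (ZMod q × ZMod q × ZMod q) = q ^ 3 := by
    simp only [Fintype.card_prod, hcard]
    ring
  obtain ⟨W, -, hW, hexp⟩ := exists_expanding_finset (quadrangleGraph f) m Finset.univ (by
    intro I _ hI
    rw [Finset.card_univ, hn]
    calc m * I.card < m * (2 * q ^ 2) := Nat.mul_lt_mul_of_pos_left (hf I hI) hm
      _ = (2 * m) * q ^ 2 := by ring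
      _ ≤ q * q ^ 2 := Nat.mul_le_mul_right _ (by omega)
      _ = q ^ 3 := by ring)
  let G := (quadrangleGraph f).comap (Subtype.val : W → ZMod q × ZMod q × ZMod q)
  have hG : G.CliqueFree 3 :=
    (quadrangleGraph_cliqueFree f).of_hom ⟨Subtype.val, fun h => h⟩
  have hV : Fintype.card (W × Fin m) = m * W.card := by simp [mul_comm]
  have hT := card_le_of_isIndepSet_tensorComplete G m (by
    intro A hA
    obtain ⟨N, hNW, hAN, hN, hle⟩ := hexp (A.map (Function.Embedding.subtype _))
      (by
        intro x hx
        obtain ⟨y, -, rfl⟩ := Finset.mem_map.mp hx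
        exact y.2)
      (by
        intro x hx y hy hxy hadj
        obtain ⟨x', hx', rfl⟩ := Finset.mem_map.mp (Finset.mem_coe.mp hx)
        obtain ⟨y', hy', rfl⟩ := Finset.mem_map.mp (Finset.mem_coe.mp hy)
        exact hA hx' hy' (fun h => hxy (by rw [h])) hadj)
    refine ⟨N.subtype (· ∈ W), ?_, ?_, ?_⟩
    · intro a ha
      exact Finset.mem_subtype.mpr (hAN (Finset.mem_map_of_mem _ ha))
    · intro v hv
      rcases (hN v.1 v.2).mp (Finset.mem_subtype.mp hv) with h | ⟨a, ha, hav⟩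
      · obtain ⟨y, hy, hyv⟩ := Finset.mem_map.mp h
        exact Or.inl (Subtype.ext hyv ▸ hy)
      · obtain ⟨y, hy, rfl⟩ := Finset.mem_map.mp ha
        exact Or.inr ⟨y, hy, hav⟩
    · rw [Finset.card_map] at hle
      rwa [Finset.card_subtype, Finset.filter_true_of_mem fun x hx => hNW hx])
  let e := Fintype.equivFin (W × Fin m)
  refine ⟨_, W.card, (G.tensorComplete m).comap e.symm, hV, Finset.card_pos.mpr hW, ?_, ?_, ?_, ?_⟩
  · calc W.card ≤ q ^ 3 := hn ▸ Finset.card_le_univ W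
      _ ≤ _ := Nat.pow_le_pow_left (by omega) 3
  · exact (hG.tensorComplete m).of_hom (Iso.comap e.symm _).toHom
  · exact (tensorComplete_colorable G m).of_hom (Iso.comap e.symm _).toHom
  · intro S hS
    have := hT (S.map e.symm.toEmbedding) (by
      intro x hx y hy hxy hadj
      obtain ⟨x', hx', rfl⟩ := Finset.mem_map.mp (Finset.mem_coe.mp hx)
      obtain ⟨y', hy', rfl⟩ := Finset.mem_map.mp (Finset.mem_coe.mp hy)
      exact hS hx' hy' (fun h => hxy (by rw [h])) hadj)
    simpa using this

end SimpleGraph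

theorem mainTheorem8 :
    ∃ C : ℝ, ∀ m : ℕ, 1 ≤ m →
      ∃ (n : ℕ) (H : SimpleGraph (Fin n)),
        H.CliqueFree 3 ∧
        H.chromaticNumber = (m : ℕ∞) ∧
        H.fractionalChromaticNumber = (m : ℝ) ∧
        (2 ≤ m → (n : ℝ) ≤ C * (m : ℝ) ^ 4 * (Real.log (m : ℝ)) ^ 2) := by
  -- The construction needs no logarithm; dividing by `log² 2` absorbs the factor `log² m` for `m ≥
  -- 2`.
  refine ⟨84 ^ 3 / Real.log 2 ^ 2, fun m hm => ?_⟩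
  obtain ⟨n, k, H, hn, hk, hkm, hfree, hcol, hind⟩ :=
    SimpleGraph.exists_triangleFree_colorable_indep_le m hm
  obtain ⟨h1, h2⟩ := SimpleGraph.chromaticNumber_eq_and_fractionalChromaticNumber_eq hm hk
    (by rw [Fintype.card_fin, hn]) hcol hind
  refine ⟨n, H, hfree, h1, h2, fun hm2 => ?_⟩
  have hlog2 : 0 < Real.log 2 := Real.log_pos one_lt_two
  have hlog : Real.log 2 ≤ Real.log m := Real.log_le_log two_pos (by exact_mod_cast hm2)
  have hnle : (n : ℝ) ≤ 84 ^ 3 * (m : ℝ) ^ 4 := by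
    have : n ≤ 84 ^ 3 * m ^ 4 := by
      calc n = m * k := hn
        _ ≤ m * (84 * m) ^ 3 := Nat.mul_le_mul_left _ hkm
        _ = 84 ^ 3 * m ^ 4 := by ring
    exact_mod_cast this
  calc (n : ℝ) ≤ 84 ^ 3 * (m : ℝ) ^ 4 := hnle
    _ = 84 ^ 3 / Real.log 2 ^ 2 * (m : ℝ) ^ 4 * Real.log 2 ^ 2 := by field_simp
    _ ≤ _ := by gcongr
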